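/- Let $n\ge 0$. For a Coxeter matrix $(m_{ij})$ the $0$-Hecke monoid is the monoid with generators $\pi_i$ and relations $\pi_i^2=\pi_i$ and the braid relations $\pi_i\pi_j\pi_i\cdots=\pi_j\pi_i\pi_j\cdots$ ($m_{ij}$ factors on each side). Let $H^0(B_n)$ be the $0$-Hecke monoid of Coxeter type $B_n$ with generators $\pi_0,\dots,\pi_{n-1}$, where $m_{01}=4$, $m_{i,i+1}=3$ for $i\ge 1$ and $m_{ij}=2$ for $|i-j|\ge 2$; let $H^0_{n+1}$ be the $0$-Hecke monoid of the symmetric group $\mathfrak S_{n+1}$, with generators $\pi_0,\dots,\pi_{n-1}$, where $m_{i,i+1}=3$ for all $i$ and $m_{ij}=2$ for $|i-j|\ge 2$. Let $R_n^0$ be the $0$-rook monoid: it has generators $\pi_1,\dots,\pi_{n-1}$, $P_1,\dots,P_n$ and relations $$\pi_i^2=\pi_i,\quad \pi_i\pi_{i+1}\pi_i=\pi_{i+1}\pi_i\pi_{i+1},\quad \pi_i\pi_j=\pi_j\pi_i\ (|i-j|\ge2),$$ $$P_i^2=P_i,\quad P_iP_j=P_jP_i,\quad P_i\pi_j=\pi_jP_i\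 (i<j),\quad P_i\pi_j=\pi_jP_i=P_i\ (j<i),\quad P_{i+1}=P_i\pi_iP_i ,$$ and we put $\pi_0:=P_1$ in $R_n^0$. There are surjective homomorphisms of $\mathbb C$-algebras $$f:\mathbb C[H^0(B_n)]\twoheadrightarrow\mathbb C[R_n^0],\qquad g:\mathbb C[R_n^0]\twoheadrightarrow\mathbb C[H^0_{n+1}]$$ with $f(\pi_i)=\pi_i$ and $g(\pi_i)=\pi_i$ for $0\le i\le n-1$, and $$\ker f\subseteq \bigl(\operatorname{rad}\mathbb C[H^0(B_n)]\bigr)^2,\qquad \ker g\subseteq\bigl(\operatorname{rad}\mathbb C[R_n^0]\bigr)^2,$$ where $\operatorname{rad}$ is the Jacobson radical. Moreover, the Ext-quivers of the three algebras $\mathbb C[H^0(B_n)]$, $\mathbb C[R_n^0]$ and $\mathbb C[H^0_{n+1}]$ are isomorphic; here the Ext-quiver of a $\mathbb C$-algebra $A$ has the isomorphism classes of simple $A$-modules as vertices and $\dim_{\mathbb C}\operatorname{Ext}^1_A(S,T)$ arrows from $S$ to $T$. -/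

import Mathlib

open CategoryTheory

/-- The defining relations of the `0`-Hecke monoid of a Coxeter matrix `M`: every generator is
idempotent, and the braid relations `π_i π_j π_i ⋯ = π_j π_i π_j ⋯` (`M i j` factors on both
sides) hold. An entry `M i j = 0` stands for `∞` and gives the empty relation `1 = 1`. -/
inductive ZeroHeckeRel {B : Type} (M : CoxeterMatrix B) : FreeMonoid B → FreeMonoid B → Prop
  | idem (i : B) : ZeroHeckeRel M (.of i * .of i) (.of i)
  | braid (i j : B) : ZeroHeckeRel M
      (FreeMonoid.ofList (CoxeterSystem.braidWord M i j))
      (FreeMonoid.ofList (CoxeterSystem.braidWord M j i))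

/-- The `0`-Hecke monoid of a Coxeter matrix. -/
abbrev ZeroHeckeMonoid {B : Type} (M : CoxeterMatrix B) : Type :=
  PresentedMonoid (ZeroHeckeRel M)

/-- The generator `π_i` of the `0`-Hecke monoid. -/
def ZeroHeckeMonoid.gen {B : Type} (M : CoxeterMatrix B) (i : B) : ZeroHeckeMonoid M :=
  PresentedMonoid.of (ZeroHeckeRel M) i

/-- The Coxeter matrix of type `B_n` with nodes `0, 1, …, n - 1`, numbered such that the edge
with label `4` joins the nodes `0` and `1` (Mathlib numbers the nodes in the opposite order). -/
def coxeterB (n : ℕ) : CoxeterMatrix (Fin n) :=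
  (CoxeterMatrix.B n).reindex Fin.revPerm

/-- The Coxeter matrix of the symmetric group on `n + 1` letters (`n` generators), with nodes
`0, 1, …, n - 1` in a path all of whose edges have label `3`. -/
def coxeterSymm (n : ℕ) : CoxeterMatrix (Fin n) :=
  CoxeterMatrix.A n

/-- The generators `π_1, …, π_{n-1}` and `P_1, …, P_n` of the `0`-rook monoid. -/
inductive RookGen (n : ℕ) : Type
  | pi (i : ℕ) (h : 1 ≤ i ∧ i < n) : RookGen n
  | P (i : ℕ) (h : 1 ≤ i ∧ i ≤ n) : RookGen n

namespace RookGen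

/-- `π_i` as a word of length one. -/
def wPi {n : ℕ} (i : ℕ) (h : 1 ≤ i ∧ i < n) : FreeMonoid (RookGen n) := .of (pi i h)

/-- `P_i` as a word of length one. -/
def wP {n : ℕ} (i : ℕ) (h : 1 ≤ i ∧ i ≤ n) : FreeMonoid (RookGen n) := .of (P i h)

end RookGen

open RookGen in
/-- The defining relations of the `0`-rook monoid. -/
inductive RookRel (n : ℕ) : FreeMonoid (RookGen n) → FreeMonoid (RookGen n) → Prop
  | pi_idem {i : ℕ} (hi : 1 ≤ i ∧ i < n) :
      RookRel n (wPi i hi * wPi i hi) (wPi i hi)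
  | pi_braid {i j : ℕ} (hi : 1 ≤ i ∧ i < n) (hj : 1 ≤ j ∧ j < n) (hij : j = i + 1) :
      RookRel n (wPi i hi * wPi j hj * wPi i hi) (wPi j hj * wPi i hi * wPi j hj)
  | pi_comm {i j : ℕ} (hi : 1 ≤ i ∧ i < n) (hj : 1 ≤ j ∧ j < n) (hij : i + 2 ≤ j ∨ j + 2 ≤ i) :
      RookRel n (wPi i hi * wPi j hj) (wPi j hj * wPi i hi)
  | P_idem {i : ℕ} (hi : 1 ≤ i ∧ i ≤ n) :
      RookRel n (wP i hi * wP i hi) (wP i hi)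
  | P_comm {i j : ℕ} (hi : 1 ≤ i ∧ i ≤ n) (hj : 1 ≤ j ∧ j ≤ n) :
      RookRel n (wP i hi * wP j hj) (wP j hj * wP i hi)
  | P_pi_comm {i j : ℕ} (hi : 1 ≤ i ∧ i ≤ n) (hj : 1 ≤ j ∧ j < n) (hij : i < j) :
      RookRel n (wP i hi * wPi j hj) (wPi j hj * wP i hi)
  | P_pi_absorb {i j : ℕ} (hi : 1 ≤ i ∧ i ≤ n) (hj : 1 ≤ j ∧ j < n) (hij : j < i) :
      RookRel n (wP i hi * wPi j hj) (wP i hi)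
  | pi_P_absorb {i j : ℕ} (hi : 1 ≤ i ∧ i ≤ n) (hj : 1 ≤ j ∧ j < n) (hij : j < i) :
      RookRel n (wPi j hj * wP i hi) (wP i hi)
  | P_succ {i j : ℕ} (hi : 1 ≤ i ∧ i ≤ n) (hi' : 1 ≤ i ∧ i < n) (hj : 1 ≤ j ∧ j ≤ n)
      (hij : j = i + 1) :
      RookRel n (wP j hj) (wP i hi * wPi i hi' * wP i hi)

/-- The `0`-rook monoid `R_n^0`. -/
abbrev ZeroRookMonoid (n : ℕ) : Type := PresentedMonoid (RookRel n)

/-- The elements `π_0, π_1, …, π_{n-1}` of `R_n^0`, where `π_0 = P_1`. -/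
def ZeroRookMonoid.gen (n : ℕ) (i : Fin n) : ZeroRookMonoid n :=
  if h : (i : ℕ) = 0 then
    PresentedMonoid.of (RookRel n) (.P 1 ⟨le_rfl, by omega⟩)
  else
    PresentedMonoid.of (RookRel n) (.pi i ⟨by omega, i.isLt⟩)

/-- The type of simple (left) modules over a ring `A`. -/
def SimpleMod (A : Type) [Ring A] : Type 1 :=
  { S : ModuleCat.{0} A // IsSimpleModule A S }

/-- Isomorphism of simple modules. -/
def simpleModSetoid (A : Type) [Ring A] : Setoid (SimpleMod A) where
  r S T := Nonempty (S.1 ≅ T.1)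
  iseqv :=
    { refl := fun S => ⟨Iso.refl S.1⟩
      symm := fun ⟨e⟩ => ⟨e.symm⟩
      trans := fun ⟨e⟩ ⟨f⟩ => ⟨e.trans f⟩ }

/-- The vertices of the Ext-quiver of a `ℂ`-algebra `A`: isomorphism classes of simple
`A`-modules. -/
def ExtQuiver (A : Type) [Ring A] : Type 1 := Quotient (simpleModSetoid A)

/-- A simple module in the isomorphism class `v`. -/
noncomputable def ExtQuiver.rep {A : Type} [Ring A] (v : ExtQuiver A) : ModuleCat.{0} A :=
  (Quotient.out (s := simpleModSetoid A) v).1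

/-- The arrows `S ⟶ T` of the Ext-quiver are the elements of a basis of the complex vector space
`Ext¹_A(S, T)`; in particular their number is the dimension of this space. -/
noncomputable instance ExtQuiver.instQuiver (A : Type) [Ring A] [Algebra ℂ A] : Quiver.{0} (ExtQuiver A) where
  Hom v w := Module.Basis.ofVectorSpaceIndex ℂ (Abelian.Ext.{0} v.rep w.rep 1)

/-!
The proof has two independent halves.

*Algebra.* Let `J` be the radical of `A`, and let `f : A → B` be surjective with kernel in `J ^ 2`.
Simple modules are killed by `J`, so restriction of scalars along `f` identifies the simple modules
of `B` and `A`. An extension of two simple modules is killed by `J ^ 2`, so `Ext¹` between them is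
also the same over `A` and over `B`. Formally, this compares the presentation `0 → 𝔪 → A → S → 0` of
a simple module with its counterpart over `B`: an `A`-linear map from `𝔪` to a simple module kills
`J * 𝔪`, which contains `ker f`, and hence factors through the image of `𝔪` in `B`
(`ModuleCat.mapExtAddHom_restrictScalars_bijective`). This gives the isomorphism of Ext-quivers in
`ExtQuiver.nonempty_iso_of_ker_le`.

*Monoids.* The three monoids are generated by idempotents `p 0, …, p (n - 1)`, and each is obtained
from the previous one by one more relation: the `0`-rook monoid is `H⁰(B_n)` modulo
`p₀ p₁ p₀ p₁ = p₀ p₁ p₀` (`IsRook.exists_hom`), and `H⁰_{n+1}` is the `0`-rook monoid modulo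
`p₀ p₁ p₀ = p₁ p₀ p₁`. With `c = p₀ p₁ - p₁ p₀`, the difference of the two sides is `(p₀ c) (c p₀)`
in the first case and `c ^ 2` in the second case. So the kernels are contained in the square of the
radical as soon as `c` lies in the radical.

To see this without knowing the size of the monoids, the coset decomposition
`B_{n+1} = ⋃ B_n d_k` of Coxeter groups is imitated in any monoid satisfying the relations of type
`B_n` (`cosetRep_mul`). It provides a finite list `t 0 = 1, …, t (N - 1)` of elements such that
right multiplication by a generator never decreases the index
(`IsHeckeB.exists_monotone_enumeration`). Hence commutators of generators strictly raise the index and generate a nilpotent two-sided ideal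
(`MonoidAlgebra.commutator_mem_jacobson`).
-/

/-! ### `Ext¹` and restriction of scalars -/

open Abelian in
/-- Dimension shifting along a comparison of projective presentations: an exact fully faithful
functor `F` induces a bijection on `Ext¹` if all maps from the presentation `R` in `D` to `F.obj T`
factor through the image of the presentation `S` in `C`. -/
theorem CategoryTheory.Functor.mapExtAddHom_one_bijective
    {C D : Type*} [Category* C] [Category* D] [Abelian C] [Abelian D] [HasExt.{0} C] [HasExt.{0} D]
    (F : C ⥤ D) [F.Additive] [Limits.PreservesFiniteLimits F] [Limits.PreservesFiniteColimits F]
    [F.Full] [F.Faithful] {S : ShortComplex C} (hS : S.ShortExact) {R : ShortComplex D}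
    (hR : R.ShortExact) [Projective S.X₂] [Projective R.X₂] (p₁ : R.X₁ ⟶ F.obj S.X₁)
    (p₂ : R.X₂ ⟶ F.obj S.X₂) (e : R.X₃ ≅ F.obj S.X₃) (comm₁₂ : p₁ ≫ F.map S.f = R.f ≫ p₂)
    (comm₂₃ : p₂ ≫ F.map S.g = R.g ≫ e.hom) [Epi p₁] (T : C)
    (h₁ : ∀ θ : R.X₁ ⟶ F.obj T, ∃ χ, p₁ ≫ χ = θ) (h₂ : ∀ θ : R.X₂ ⟶ F.obj T, ∃ χ, p₂ ≫ χ = θ) :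
    Function.Bijective (F.mapExtAddHom S.X₃ T 1) := by
  have key : hS.extClass.mapExactFunctor F = (Ext.mk₀ e.inv).comp
      (hR.extClass.comp (Ext.mk₀ p₁) (add_zero 1)) (zero_add 1) := by
    have h : hR.extClass.comp (Ext.mk₀ p₁) (add_zero 1) =
        (Ext.mk₀ e.hom).comp (hS.extClass.mapExactFunctor F) (zero_add 1) := by
      rw [Ext.mapExactFunctor_extClass]
      exact ShortComplex.ShortExact.extClass_naturality hR (hS.map_of_exact F)
        { τ₁ := p₁, τ₂ := p₂, τ₃ := e.hom, comm₁₂ := comm₁₂, comm₂₃ := comm₂₃ }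
    rw [h, Ext.mk₀_comp_mk₀_assoc, e.inv_hom_id, Ext.mk₀_id_comp]
  have hmap (χ : S.X₁ ⟶ T) : (hS.extClass.comp (Ext.mk₀ χ) (add_zero 1)).mapExactFunctor F =
      (Ext.mk₀ e.inv).comp
        (hR.extClass.comp (Ext.mk₀ (p₁ ≫ F.map χ)) (add_zero 1)) (zero_add 1) := by
    rw [Ext.mapExactFunctor_comp, Ext.mapExactFunctor_mk₀, key,
      ← Ext.mk₀_comp_mk₀, Ext.comp_assoc_of_third_deg_zero,
      ← Ext.comp_assoc_of_third_deg_zero hR.extClass]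
  constructor
  · rw [injective_iff_map_eq_zero]
    intro x hx
    obtain ⟨x', rfl⟩ := Ext.contravariant_sequence_exact₃ hS T x
      (Ext.eq_zero_of_projective _) (n₀ := 0) rfl
    obtain ⟨χ, rfl⟩ := (Ext.mk₀_bijective _ _).2 x'
    rw [Functor.mapExtAddHom_apply, hmap] at hx
    have hx' := congrArg (fun y => (Ext.mk₀ e.hom).comp y (zero_add 1)) hx
    simp only [Ext.mk₀_comp_mk₀_assoc, Iso.hom_inv_id, Ext.mk₀_id_comp, Ext.comp_zero] at hx'
    obtain ⟨ψ', hψ'⟩ := Ext.contravariant_sequence_exact₁ hR _ _ rfl hx'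
    obtain ⟨ψ, rfl⟩ := (Ext.mk₀_bijective _ _).2 ψ'
    rw [Ext.mk₀_comp_mk₀] at hψ'
    replace hψ' := (Ext.mk₀_bijective _ _).1 hψ'
    obtain ⟨ω', rfl⟩ := h₂ ψ
    obtain ⟨ω, rfl⟩ := F.map_surjective ω'
    have hc : p₁ ≫ F.map (S.f ≫ ω) = p₁ ≫ F.map χ := by
      rw [← hψ', ← Category.assoc, ← comm₁₂, F.map_comp, Category.assoc]
    rw [cancel_epi] at hc
    rw [← F.map_injective hc, ← Ext.mk₀_comp_mk₀]
    exact hS.extClass_comp_assoc _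
  · intro y
    obtain ⟨y', hy'⟩ := Ext.contravariant_sequence_exact₃ hR (F.obj T)
      ((Ext.mk₀ e.hom).comp y (zero_add 1)) (Ext.eq_zero_of_projective _) (n₀ := 0) rfl
    obtain ⟨θ, rfl⟩ := (Ext.mk₀_bijective _ _).2 y'
    obtain ⟨χ', rfl⟩ := h₁ θ
    obtain ⟨χ, rfl⟩ := F.map_surjective χ'
    refine ⟨hS.extClass.comp (Ext.mk₀ χ) (add_zero 1), ?_⟩
    rw [Functor.mapExtAddHom_apply, hmap, hy', Ext.mk₀_comp_mk₀_assoc, e.inv_hom_id,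
      Ext.mk₀_id_comp]

section Restrict
variable {A B : Type} [Ring A] [Ring B] (f : A →+* B)

theorem ModuleCat.restrictScalars_full (hf : Function.Surjective f) :
    (ModuleCat.restrictScalars.{0} f).Full where
  map_surjective {M N} g := by
    refine ⟨ModuleCat.ofHom
      { toFun := g.hom, map_add' := g.hom.map_add, map_smul' := fun b m => ?_ }, rfl⟩
    obtain ⟨a, rfl⟩ := hf b
    exact g.hom.map_smul a m

theorem ModuleCat.isSimpleModule_restrictScalars_iff (hf : Function.Surjective f)
    (S : ModuleCat.{0} B) :
    IsSimpleModule A ((ModuleCat.restrictScalars f).obj S) ↔ IsSimpleModule B S := by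
  have : RingHomSurjective f := ⟨hf⟩
  let l : ((ModuleCat.restrictScalars f).obj S) →ₛₗ[f] S :=
    { toFun := fun x => x, map_add' := fun _ _ => rfl, map_smul' := fun _ _ => rfl }
  exact LinearMap.isSimpleModule_iff_of_bijective l Function.bijective_id

/-- A module killed by the kernel of a surjection is a restriction of scalars. -/
theorem ModuleCat.exists_restrictScalars_iso (hf : Function.Surjective f) (M : ModuleCat.{0} A)
    (hM : ∀ a, f a = 0 → ∀ m : M, a • m = 0) :
    ∃ N : ModuleCat.{0} B, Nonempty ((ModuleCat.restrictScalars f).obj N ≅ M) := by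
  let ρ : B →+* AddMonoid.End M := f.liftOfRightInverse (Function.surjInv hf)
    (Function.rightInverse_surjInv hf) ⟨Module.toAddMonoidEnd A M, fun a ha => by
      ext m; exact hM a ha m⟩
  have hρ (a : A) (m : M) : ρ (f a) m = a • m :=
    DFunLike.congr_fun (f.liftOfRightInverse_comp_apply _ _ ⟨Module.toAddMonoidEnd A M, _⟩ a) m
  let _ : Module B M := Module.compHom M ρ
  obtain ⟨N, e, he⟩ : ∃ (N : ModuleCat.{0} B) (e : N ≃+ M), ∀ a x, e (f a • x) = a • e x :=
    ⟨ModuleCat.of B M, AddEquiv.refl M, hρ⟩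
  let l : (ModuleCat.restrictScalars f).obj N ≃ₗ[A] M := { e with map_smul' := he }
  exact ⟨N, ⟨l.toModuleIso⟩⟩


theorem ModuleCat.restrictScalars_exact_map (S : ShortComplex (ModuleCat.{0} B)) (h : S.Exact) :
    (S.map (ModuleCat.restrictScalars.{0} f)).Exact := by
  rw [ShortComplex.ShortExact.moduleCat_exact_iff_function_exact] at h ⊢
  exact h

instance ModuleCat.restrictScalars_preservesFiniteLimits :
    Limits.PreservesFiniteLimits (ModuleCat.restrictScalars.{0} f) :=
  have h : Limits.PreservesFiniteLimits (ModuleCat.restrictScalars.{0} f) ∧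
      Limits.PreservesFiniteColimits (ModuleCat.restrictScalars.{0} f) :=
    ((ModuleCat.restrictScalars.{0} f).exact_tfae.out 1 3).mp
      (ModuleCat.restrictScalars_exact_map f)
  h.1

instance ModuleCat.restrictScalars_preservesFiniteColimits :
    Limits.PreservesFiniteColimits (ModuleCat.restrictScalars.{0} f) :=
  have h : Limits.PreservesFiniteLimits (ModuleCat.restrictScalars.{0} f) ∧
      Limits.PreservesFiniteColimits (ModuleCat.restrictScalars.{0} f) :=
    ((ModuleCat.restrictScalars.{0} f).exact_tfae.out 1 3).mp
      (ModuleCat.restrictScalars_exact_map f)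
  h.2

theorem LinearMap.exists_comp_eq_of_ker_le {M N P : Type*} [AddCommGroup M] [AddCommGroup N]
    [AddCommGroup P] [Module A M] [Module A N] [Module A P] {p : M →ₗ[A] N}
    (hp : Function.Surjective p) {θ : M →ₗ[A] P} (h : LinearMap.ker p ≤ LinearMap.ker θ) :
    ∃ χ : N →ₗ[A] P, χ.comp p = θ := by
  refine ⟨((LinearMap.ker p).liftQ θ h).comp (p.quotKerEquivOfSurjective hp).symm.toLinearMap, ?_⟩
  ext x
  have : (p.quotKerEquivOfSurjective hp).symm (p x) = (LinearMap.ker p).mkQ x := by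
    rw [LinearEquiv.symm_apply_eq]; rfl
  simp [this]

open Abelian in
/-- `Ext¹` between simple modules only depends on the ring modulo the square of its Jacobson
radical. -/
theorem ModuleCat.mapExtAddHom_restrictScalars_bijective (hf : Function.Surjective f)
    (hker : RingHom.ker f ≤ Ring.jacobson A ^ 2) (S T : ModuleCat.{0} B) [IsSimpleModule B S]
    [IsSimpleModule B T] :
    Function.Bijective ((ModuleCat.restrictScalars.{0} f).mapExtAddHom S T 1) := by
  have := ModuleCat.restrictScalars_full f hf
  set F := ModuleCat.restrictScalars.{0} f with hF
  have hS : IsSimpleModule A (F.obj S) :=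
    (ModuleCat.isSimpleModule_restrictScalars_iff f hf S).2 ‹_›
  have hT : IsSimpleModule A (F.obj T) :=
    (ModuleCat.isSimpleModule_restrictScalars_iff f hf T).2 ‹_›
  have := IsSimpleModule.nontrivial B S
  obtain ⟨s, hs⟩ := exists_ne (0 : S)
  let gA : A →ₗ[A] F.obj S := LinearMap.toSpanSingleton A (F.obj S) s
  let gB : B →ₗ[B] S := LinearMap.toSpanSingleton B S s
  have hgA : Function.Surjective gA := IsSimpleModule.toSpanSingleton_surjective A hs
  have hgB : Function.Surjective gB := IsSimpleModule.toSpanSingleton_surjective B hs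
  -- the radical of `A` kills `S` and `T`
  have hradS : Ring.jacobson A ≤ LinearMap.ker gA := IsSemisimpleModule.jacobson_le_ker _ _ _ _ gA
  have hradT (a : A) (ha : a ∈ Ring.jacobson A) (t : F.obj T) : a • t = 0 :=
    Module.mem_annihilator.1 (IsSemisimpleModule.jacobson_le_annihilator A (F.obj T) ha) t
  have hkerT (a : A) (ha : f a = 0) (t : F.obj T) : a • t = 0 := by
    change f a • (show T from t) = 0
    rw [ha, zero_smul]
  let p₁ : LinearMap.ker gA →ₗ[A] F.obj (ModuleCat.of B (LinearMap.ker gB)) :=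
    { toFun := fun x => (⟨f x, x.2⟩ : LinearMap.ker gB)
      map_add' := fun x y => Subtype.ext (map_add f _ _)
      map_smul' := fun a x => Subtype.ext (map_mul f _ _) }
  let p₂ : A →ₗ[A] F.obj (ModuleCat.of B B) :=
    { toFun := fun x => f x, map_add' := map_add f, map_smul' := map_mul f }
  have hp₁ : Function.Surjective p₁ := by
    rintro ⟨b, hb⟩
    obtain ⟨a, rfl⟩ := hf b
    exact ⟨⟨a, hb⟩, rfl⟩
  have hp₂ : Function.Surjective p₂ := hf
  let q₁ : gA.shortComplexKer.X₁ ⟶ F.obj gB.shortComplexKer.X₁ :=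
    ModuleCat.ofHom (Y := F.obj (ModuleCat.of B (LinearMap.ker gB))) p₁
  let q₂ : gA.shortComplexKer.X₂ ⟶ F.obj gB.shortComplexKer.X₂ :=
    ModuleCat.ofHom (Y := F.obj (ModuleCat.of B B)) p₂
  have : Epi q₁ := (ModuleCat.epi_iff_surjective _).2 hp₁
  have : Projective gA.shortComplexKer.X₂ :=
    inferInstanceAs (Projective (ModuleCat.of A A))
  have : Projective gB.shortComplexKer.X₂ :=
    inferInstanceAs (Projective (ModuleCat.of B B))
  refine F.mapExtAddHom_one_bijective (LinearMap.shortExact_shortComplexKer hgB)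
    (LinearMap.shortExact_shortComplexKer hgA) q₁ q₂
    (Iso.refl _) rfl rfl T (fun θ => ?_) (fun θ => ?_)
  · obtain ⟨χ, hχ⟩ := LinearMap.exists_comp_eq_of_ker_le hp₁ (θ := θ.hom) (by
      intro x hx
      have hfx : f x = 0 := congrArg Subtype.val hx
      -- An element of `J ^ 2` is a sum of products `r * r'` with `r' ∈ J ≤ ker gA`, and
      -- `θ (r * r') = r • θ r'` vanishes because `J` kills `T`.
      have hle : Ring.jacobson A ^ 2 ≤ (LinearMap.ker θ.hom).map (LinearMap.ker gA).subtype := by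
        rw [Submodule.pow_succ, Submodule.pow_one, Submodule.mul_le]
        intro r hr r' hr'
        refine ⟨r • ⟨r', hradS hr'⟩, ?_, rfl⟩
        rw [SetLike.mem_coe, LinearMap.mem_ker, map_smul]
        exact hradT r hr _
      obtain ⟨y, hy, hyx⟩ := hle (hker hfx)
      rwa [← Subtype.ext hyx])
    exact ⟨ModuleCat.ofHom (X := F.obj (ModuleCat.of B (LinearMap.ker gB))) (Y := F.obj T) χ,
      ModuleCat.hom_ext hχ⟩
  · obtain ⟨χ, hχ⟩ := LinearMap.exists_comp_eq_of_ker_le hp₂ (θ := θ.hom) (by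
      intro x hx
      have h1 : θ.hom (x • (1 : A)) = x • θ.hom (1 : A) := map_smul _ _ _
      rw [hkerT x hx, smul_eq_mul, mul_one] at h1
      exact h1)
    exact ⟨ModuleCat.ofHom (X := F.obj (ModuleCat.of B B)) (Y := F.obj T) χ, ModuleCat.hom_ext hχ⟩

end Restrict

/-! ### Ext-quivers -/

theorem Module.Basis.nonempty_ofVectorSpaceIndex_equiv {K V W : Type*} [Field K] [AddCommGroup V]
    [AddCommGroup W] [Module K V] [Module K W] (e : V ≃ₗ[K] W) :
    Nonempty (Module.Basis.ofVectorSpaceIndex K V ≃ Module.Basis.ofVectorSpaceIndex K W) :=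
  ⟨((Module.Basis.ofVectorSpace K V).map e).indexEquiv (Module.Basis.ofVectorSpace K W)⟩

open Abelian in
/-- The linear isomorphism between `Ext`-spaces induced by isomorphisms of both arguments. -/
noncomputable def CategoryTheory.Abelian.Ext.linearEquivOfIso (K : Type*) [Field K] {C : Type*}
    [Category* C] [Abelian C] [Linear K C] [HasExt.{0} C] {X X' Y Y' : C} (e : X ≅ X')
    (e' : Y ≅ Y') (n : ℕ) : Ext X Y n ≃ₗ[K] Ext X' Y' n where
  toFun x := (Ext.mk₀ e.inv).comp (x.comp (Ext.mk₀ e'.hom) (add_zero n)) (zero_add n)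
  invFun x := (Ext.mk₀ e.hom).comp (x.comp (Ext.mk₀ e'.inv) (add_zero n)) (zero_add n)
  map_add' := by simp
  map_smul' := by simp
  left_inv x := by
    simp [Ext.comp_assoc_of_third_deg_zero]
  right_inv x := by
    simp [Ext.comp_assoc_of_third_deg_zero]

theorem ExtQuiver.isSimpleModule_rep {A : Type} [Ring A] (v : ExtQuiver A) :
    IsSimpleModule A v.rep :=
  (Quotient.out (s := simpleModSetoid A) v).2

section Quiver
variable {A B : Type} [Ring A] [Ring B]

/-- The vertex of the Ext-quiver given by a simple module. -/
def ExtQuiver.mk (S : ModuleCat.{0} A) (hS : IsSimpleModule A S) : ExtQuiver A :=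
  Quotient.mk (simpleModSetoid A) ⟨S, hS⟩

theorem ExtQuiver.mk_eq_mk_iff {S T : ModuleCat.{0} A} {hS : IsSimpleModule A S}
    {hT : IsSimpleModule A T} : ExtQuiver.mk S hS = ExtQuiver.mk T hT ↔ Nonempty (S ≅ T) :=
  Quotient.eq (r := simpleModSetoid A)

theorem ExtQuiver.mk_rep (v : ExtQuiver A) : ExtQuiver.mk v.rep v.isSimpleModule_rep = v :=
  Quotient.out_eq (s := simpleModSetoid A) v

/-- A surjection of algebras whose kernel lies in the square of the radical does not change the
Ext-quiver. -/
theorem ExtQuiver.nonempty_iso_of_ker_le [Algebra ℂ A] [Algebra ℂ B] (f : A →ₐ[ℂ] B)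
    (hf : Function.Surjective f) (hker : RingHom.ker f ≤ Ring.jacobson A ^ 2) :
    Nonempty (Quiv.of (ExtQuiver A) ≅ Quiv.of (ExtQuiver B)) := by
  have := ModuleCat.restrictScalars_full f.toRingHom hf
  set F := ModuleCat.restrictScalars.{0} f.toRingHom with hF
  let φ : ExtQuiver B → ExtQuiver A := fun v => ExtQuiver.mk (F.obj v.rep)
    ((ModuleCat.isSimpleModule_restrictScalars_iff f.toRingHom hf _).2 v.isSimpleModule_rep)
  have hφ : Function.Bijective φ := by
    constructor
    · intro v w h
      obtain ⟨e⟩ := ExtQuiver.mk_eq_mk_iff.1 h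
      rw [← v.mk_rep, ← w.mk_rep, ExtQuiver.mk_eq_mk_iff]
      exact ⟨F.preimageIso e⟩
    · intro v
      have hv := v.isSimpleModule_rep
      obtain ⟨N, ⟨e⟩⟩ := ModuleCat.exists_restrictScalars_iso f.toRingHom hf v.rep fun a ha m =>
        Module.mem_annihilator.1 (IsSemisimpleModule.jacobson_le_annihilator A v.rep
          (Ideal.pow_le_self two_ne_zero (hker ha))) m
      have hN : IsSimpleModule B N := (ModuleCat.isSimpleModule_restrictScalars_iff _ hf N).1
        (e.toLinearEquiv.isSimpleModule_iff.2 hv)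
      refine ⟨ExtQuiver.mk N hN, ?_⟩
      obtain ⟨e'⟩ := ExtQuiver.mk_eq_mk_iff.1 (ExtQuiver.mk_rep (ExtQuiver.mk N hN))
      rw [← v.mk_rep, ExtQuiver.mk_eq_mk_iff]
      exact ⟨F.mapIso e' ≪≫ e⟩
  have harr (v w : ExtQuiver B) : Nonempty ((v ⟶ w) ≃ (φ v ⟶ φ w)) := by
    have hv := v.isSimpleModule_rep
    have hw := w.isSimpleModule_rep
    obtain ⟨ev⟩ := ExtQuiver.mk_eq_mk_iff.1 (ExtQuiver.mk_rep (φ v))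
    obtain ⟨ew⟩ := ExtQuiver.mk_eq_mk_iff.1 (ExtQuiver.mk_rep (φ w))
    have hbij : Function.Bijective (F.mapExtLinearMap ℂ v.rep w.rep 1) :=
      ModuleCat.mapExtAddHom_restrictScalars_bijective f.toRingHom hf hker v.rep w.rep
    exact Module.Basis.nonempty_ofVectorSpaceIndex_equiv ((LinearEquiv.ofBijective _ hbij).trans
      (Abelian.Ext.linearEquivOfIso ℂ ev.symm ew.symm 1))
  exact ⟨(Quiv.isoOfEquiv (Equiv.ofBijective φ hφ) fun v w => (harr v w).some).symm⟩

end Quiver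

/-! ### The relations of type `B` and coset representatives -/

/-- The relations shared by all monoids here: `p 0, …, p (n - 1)` are idempotents which commute
unless they are neighbours, and `p 1, …, p (n - 1)` satisfy the braid relations of length three.
Nothing is asked of the pair `p 0`, `p 1`. -/
structure IsPathHecke (n : ℕ) {M : Type*} [Monoid M] (p : ℕ → M) : Prop where
  idem : ∀ i < n, p i * p i = p i
  comm : ∀ i j, i + 2 ≤ j → j < n → p i * p j = p j * p i
  braid : ∀ i, 1 ≤ i → i + 1 < n → p i * p (i + 1) * p i = p (i + 1) * p i * p (i + 1)

/-- The relations of the `0`-Hecke monoid of type `B_n`. -/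
structure IsHeckeB (n : ℕ) {M : Type*} [Monoid M] (p : ℕ → M) : Prop
    extends IsPathHecke n p where
  braid₀ : 1 < n → p 0 * p 1 * p 0 * p 1 = p 1 * p 0 * p 1 * p 0

namespace IsHeckeB
variable {M : Type*} [Monoid M] {n m : ℕ} {p : ℕ → M}

theorem mono (h : IsHeckeB n p) (hmn : m ≤ n) : IsHeckeB m p where
  idem i hi := h.idem i (hi.trans_le hmn)
  comm i j hij hj := h.comm i j hij (hj.trans_le hmn)
  braid i hi hi' := h.braid i hi (hi'.trans_le hmn)
  braid₀ h1 := h.braid₀ (h1.trans_le hmn)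

end IsHeckeB

section Coset
variable {M : Type*} [Monoid M] (p : ℕ → M)

/-- The minimal length representatives of the right cosets of the parabolic subgroup `B_n` in
`B_{n+1}`, read in the monoid: `cosetRep p n k` is the prefix of length `k` of the word
`p n, …, p 1, p 0, p 1, …, p n`. Only the values at `k ≤ 2 * n + 1` are meaningful. -/
def cosetRep : ℕ → ℕ → M
  | _, 0 => 1
  | 0, _ + 1 => p 0
  | n + 1, k + 1 =>
    if k ≤ 2 * n + 1 then p (n + 1) * cosetRep n k
    else p (n + 1) * cosetRep n (2 * n + 1) * p (n + 1)

variable {p}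

@[simp] theorem cosetRep_zero_right (n : ℕ) : cosetRep p n 0 = 1 := by
  cases n <;> rfl

theorem cosetRep_succ_of_le {n k : ℕ} (hk : k ≤ 2 * n + 1) :
    cosetRep p (n + 1) (k + 1) = p (n + 1) * cosetRep p n k := by
  rw [cosetRep, if_pos hk]

theorem cosetRep_last (n : ℕ) :
    cosetRep p (n + 1) (2 * n + 3) = p (n + 1) * cosetRep p n (2 * n + 1) * p (n + 1) := by
  rw [cosetRep, if_neg (by omega)]

theorem commute_cosetRep {N n m : ℕ} (h : IsHeckeB N p) (hm : m < N) (hnm : n + 2 ≤ m) (k : ℕ) :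
    Commute (p m) (cosetRep p n k) := by
  have hc (i : ℕ) (hi : i + 2 ≤ m) : Commute (p m) (p i) := (h.comm i m hi hm).symm
  induction n generalizing k with
  | zero =>
    cases k with
    | zero => simp
    | succ k => exact hc 0 hnm
  | succ n ih =>
    cases k with
    | zero => simp
    | succ k =>
      rw [cosetRep]
      split_ifs
      · exact (hc _ hnm).mul_right (ih (by omega) _)
      · exact ((hc _ hnm).mul_right (ih (by omega) _)).mul_right (hc _ hnm)

/-- Multiplying a coset representative by a generator fixes it, leads to the next one, or moves
a generator of the parabolic submonoid to the left. -/
theorem cosetRep_mul {n : ℕ} (h : IsHeckeB (n + 1) p) {k i : ℕ} (hk : k ≤ 2 * n + 1) (hi : i ≤ n) :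
    cosetRep p n k * p i = cosetRep p n k ∨
      (k < 2 * n + 1 ∧ cosetRep p n k * p i = cosetRep p n (k + 1)) ∨
      ∃ i' < n, cosetRep p n k * p i = p i' * cosetRep p n k := by
  induction n generalizing k i with
  | zero =>
    obtain rfl : i = 0 := by omega
    interval_cases k
    · exact Or.inr (Or.inl ⟨by omega, by simp [cosetRep]⟩)
    · exact Or.inl (h.idem 0 one_pos)
  | succ n ih =>
    specialize @ih (h.mono (Nat.le_succ _))
    have hidem := h.idem (n + 1) (by omega)
    obtain _ | k := k
    · rcases eq_or_lt_of_le hi with rfl | hi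
      · exact Or.inr (Or.inl ⟨by omega, by simp [cosetRep_succ_of_le]⟩)
      · exact Or.inr (Or.inr ⟨i, hi, by simp⟩)
    rcases Nat.lt_or_ge (2 * n + 1) k with hk' | hk'
    · -- the longest representative
      obtain rfl : k = 2 * n + 2 := by omega
      rw [cosetRep_last]
      rcases eq_or_lt_of_le hi with rfl | hi
      · exact Or.inl (by rw [mul_assoc, hidem])
      obtain rfl | hin : i = n ∨ i + 1 ≤ n := by omega
      · refine Or.inr (Or.inr ⟨i, hi, ?_⟩)
        obtain _ | i := i
        · simpa [cosetRep, mul_assoc] using (h.braid₀ (by omega)).symm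
        · have hb := h.braid (i + 1) (by omega) (by omega)
          have hc := (commute_cosetRep h (m := i + 2) (n := i) (by omega) le_rfl
            (2 * i + 1)).eq
          rw [show 2 * (i + 1) + 1 = 2 * i + 3 from rfl, cosetRep_last]
          generalize cosetRep p i (2 * i + 1) = X at *
          simp only [show i + 1 + 1 = i + 2 from rfl] at *
          generalize p (i + 2) = b at *
          generalize p (i + 1) = a at *
          calc b * (a * X * a) * b * a = b * a * X * (a * b * a) := by simp only [mul_assoc]
            _ = b * a * (X * b) * a * b := by rw [hb]; simp only [mul_assoc]
            _ = (b * a * b) * X * a * b := by rw [← hc]; simp only [mul_assoc]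
            _ = a * (b * (a * X * a) * b) := by rw [← hb]; simp only [mul_assoc]
      · have hi₁ := h.comm i (n + 1) (by omega) (by omega)
        rcases ih (k := 2 * n + 1) (i := i) le_rfl (by omega) with hX | ⟨hX, -⟩ | ⟨j, hj, hX⟩
        · exact Or.inl (by rw [mul_assoc, ← hi₁, ← mul_assoc, mul_assoc (p (n + 1)), hX])
        · omega
        · have hj₁ := h.comm j (n + 1) (by omega) (by omega)
          refine Or.inr (Or.inr ⟨j, by omega, ?_⟩)
          rw [mul_assoc, ← hi₁, ← mul_assoc, mul_assoc (p (n + 1)), hX, ← mul_assoc, ← hj₁]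
          simp only [mul_assoc]
    · rw [cosetRep_succ_of_le hk']
      rcases eq_or_lt_of_le hi with rfl | hi
      · obtain _ | k := k
        · exact Or.inl (by simp [hidem])
        rcases eq_or_lt_of_le hk' with hk' | hk'
        · refine Or.inr (Or.inl ⟨by omega, ?_⟩)
          rw [hk', cosetRep_last]
        · obtain _ | n := n
          · omega
          -- the representative is `p (n + 2) * p (n + 1) * cosetRep p n k`, and the additional
          -- `p (n + 2)` commutes with the last factor, so that the braid relation applies
          refine Or.inr (Or.inr ⟨n + 1, by omega, ?_⟩)
          have hc := (commute_cosetRep h (m := n + 2) (n := n) (by omega) le_rfl k).eq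
          have hb := h.braid (n + 1) (by omega) (by omega)
          rw [cosetRep_succ_of_le (by omega), mul_assoc, mul_assoc, ← hc]
          simp only [← mul_assoc]
          rw [← hb]
      · rcases ih (k := k) (i := i) hk' (by omega) with hX | ⟨hX, hX'⟩ | ⟨j, hj, hX⟩
        · exact Or.inl (by rw [mul_assoc, hX])
        · exact Or.inr (Or.inl ⟨by omega, by
            rw [mul_assoc, hX', cosetRep_succ_of_le (by omega)]⟩)
        · have hj₁ := h.comm j (n + 1) (by omega) (by omega)
          refine Or.inr (Or.inr ⟨j, by omega, ?_⟩)
          rw [mul_assoc, hX, ← mul_assoc, ← hj₁, mul_assoc]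

end Coset

/-- The monoid generated by `p 0, …, p (n - 1)` is finite and its right regular representation is
triangular: in the enumeration `t 0 = 1, …, t (N - 1)`, right multiplication by a generator never
decreases the index. Repetitions are allowed. -/
theorem IsHeckeB.exists_monotone_enumeration {M : Type*} [Monoid M] {n : ℕ} {p : ℕ → M}
    (h : IsHeckeB n p) : ∃ (N : ℕ) (t : ℕ → M), 0 < N ∧ t 0 = 1 ∧
      ∀ a < N, ∀ i < n, ∃ b, a ≤ b ∧ b < N ∧ t a * p i = t b := by
  induction n with
  | zero => exact ⟨1, fun _ => 1, one_pos, rfl, by simp⟩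
  | succ n ih =>
    obtain ⟨N, t, hN, ht, htp⟩ := ih (h.mono n.le_succ)
    let u (a : ℕ) : M := t (a % N) * cosetRep p n (a / N)
    have hu (q r : ℕ) (hr : r < N) : u (N * q + r) = t r * cosetRep p n q := by
      simp only [u, Nat.mul_add_mod, Nat.mod_eq_of_lt hr, Nat.mul_add_div hN,
        Nat.div_eq_of_lt hr, add_zero]
    -- lexicographic order, with the coset as the first coordinate
    refine ⟨N * (2 * n + 2), u, by positivity, by simp [u, ht], fun a ha i hi => ?_⟩
    obtain ⟨q, r, hr, hq, rfl⟩ : ∃ q r, r < N ∧ q ≤ 2 * n + 1 ∧ a = N * q + r :=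
      ⟨a / N, a % N, Nat.mod_lt _ hN, Nat.lt_succ_iff.1 (Nat.div_lt_of_lt_mul ha),
        (Nat.div_add_mod a N).symm⟩
    have hbound (q r : ℕ) (hr : r < N) (hq : q ≤ 2 * n + 1) : N * q + r < N * (2 * n + 2) := by
      nlinarith
    rw [hu q r hr, mul_assoc]
    rcases cosetRep_mul h hq (Nat.lt_succ_iff.1 hi) with hX | ⟨hq', hX⟩ | ⟨j, hj, hX⟩
    · exact ⟨N * q + r, le_rfl, ha, by rw [hX, hu q r hr]⟩
    · exact ⟨N * (q + 1) + r, by nlinarith, hbound _ _ hr (by omega), by rw [hX, hu _ r hr]⟩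
    · obtain ⟨r', hrr', hr', hr''⟩ := htp r hr j hj
      exact ⟨N * q + r', by omega, hbound _ _ hr' hq, by rw [hX, ← mul_assoc, hr'', hu q r' hr']⟩

/-! ### Commutators of generators lie in the radical -/

section Radical

theorem mem_jacobson_of_isNilpotent_mul {A : Type*} [Ring A] {u : A}
    (h : ∀ y, IsNilpotent (y * u)) : u ∈ Ring.jacobson A := by
  rw [← Ideal.jacobson_bot, Ideal.mem_jacobson_iff]
  intro y
  obtain ⟨z, hz⟩ := (h y).isUnit_one_add.exists_left_inv
  refine ⟨z, ?_⟩
  rw [Ideal.mem_bot, ← hz]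
  noncomm_ring

/-- If the elements of `M` can be enumerated finitely such that right multiplication by a generator
never decreases the index, then the commutators of the generators act on the right of the monoid
algebra by strictly triangular matrices, and so they lie in the Jacobson radical. -/
theorem MonoidAlgebra.commutator_mem_jacobson {K M : Type*} [CommRing K] [Monoid M] {N : ℕ}
    {t : ℕ → M} {G : Set M} (hG : Submonoid.closure G = ⊤) (hN : 0 < N) (ht : t 0 = 1)
    (htG : ∀ a < N, ∀ x ∈ G, ∃ b, a ≤ b ∧ b < N ∧ t a * x = t b) {x y : M} (hx : x ∈ G)
    (hy : y ∈ G) :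
    of K M x * of K M y - of K M y * of K M x ∈ Ring.jacobson (MonoidAlgebra K M) := by
  have htM (m : M) : ∀ a < N, ∃ b, a ≤ b ∧ b < N ∧ t a * m = t b := by
    refine Submonoid.dense_induction
      (motive := fun m => ∀ a < N, ∃ b, a ≤ b ∧ b < N ∧ t a * m = t b) G hG
      (fun m hm a ha => htG a ha m hm) (fun a ha => ⟨a, le_rfl, ha, mul_one _⟩)
      (fun m m' hm hm' a ha => ?_) m
    obtain ⟨b, hab, hb, h⟩ := hm a ha
    obtain ⟨c, hbc, hc, h'⟩ := hm' b hb
    exact ⟨c, hab.trans hbc, hc, by rw [← mul_assoc, h, h']⟩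
  -- the right ideals `V 0 ⊇ V 1 ⊇ … ⊇ V N = 0` with `1 ∈ V 0`
  let V (j : ℕ) : Submodule K (MonoidAlgebra K M) :=
    Submodule.span K {v | ∃ b, j ≤ b ∧ b < N ∧ v = of K M (t b)}
  have hVanti {i j : ℕ} (hij : i ≤ j) : V j ≤ V i :=
    Submodule.span_mono fun v ⟨b, hb, hb', hv⟩ => ⟨b, hij.trans hb, hb', hv⟩
  have hVmem {j b : ℕ} (hj : j ≤ b) (hb : b < N) : of K M (t b) ∈ V j :=
    Submodule.subset_span ⟨b, hj, hb, rfl⟩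
  have hVN : V N = ⊥ := by
    rw [Submodule.span_eq_bot]
    rintro v ⟨b, hb, hb', -⟩
    omega
  have hVmul {i j : ℕ} {u : MonoidAlgebra K M}
      (hu : ∀ b, i ≤ b → b < N → of K M (t b) * u ∈ V j) {v : MonoidAlgebra K M} (hv : v ∈ V i) :
      v * u ∈ V j := by
    induction hv using Submodule.span_induction with
    | mem v hv => obtain ⟨b, hb, hb', rfl⟩ := hv; exact hu b hb hb'
    | zero => simp
    | add v w _ _ hv hw => rw [add_mul]; exact add_mem hv hw
    | smul c v _ hv => rw [smul_mul_assoc]; exact Submodule.smul_mem _ c hv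
  have hVmulA {j : ℕ} {v : MonoidAlgebra K M} (hv : v ∈ V j) (w : MonoidAlgebra K M) :
      v * w ∈ V j := by
    refine hVmul (fun b hb hb' => ?_) hv
    induction w using MonoidAlgebra.induction_on with
    | of m =>
      obtain ⟨c, hc, hc', h⟩ := htM m b hb'
      rw [← map_mul, h]
      exact hVmem (hb.trans hc) hc'
    | add v w hv hw => rw [mul_add]; exact add_mem hv hw
    | smul c v hv => rw [mul_smul_comm]; exact Submodule.smul_mem _ c hv
  -- the commutator raises the index
  have hcomm {j : ℕ} {v : MonoidAlgebra K M} (hv : v ∈ V j) :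
      v * (of K M x * of K M y - of K M y * of K M x) ∈ V (j + 1) := by
    refine hVmul (fun b hb hb' => ?_) hv
    have hfix (x : M) (hx : x ∈ G) : of K M (t b) * of K M x = of K M (t b) ∨
        of K M (t b) * of K M x ∈ V (b + 1) := by
      obtain ⟨c, hc, hc', h⟩ := htG b hb' x hx
      rw [← map_mul, h]
      rcases eq_or_lt_of_le hc with rfl | hc
      · exact Or.inl rfl
      · exact Or.inr (hVmem hc hc')
    refine hVanti (Nat.succ_le_succ hb) ?_
    rw [mul_sub, ← mul_assoc, ← mul_assoc]
    rcases hfix x hx with h₁ | h₁ <;> rcases hfix y hy with h₂ | h₂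
    · rw [h₁, h₂, h₁, sub_self]
      exact zero_mem _
    · rw [h₁]
      exact sub_mem h₂ (hVmulA h₂ _)
    · rw [h₂]
      exact sub_mem (hVmulA h₁ _) h₁
    · exact sub_mem (hVmulA h₁ _) (hVmulA h₂ _)
  refine mem_jacobson_of_isNilpotent_mul fun z => ⟨N, ?_⟩
  have hpow (k : ℕ) : (z * (of K M x * of K M y - of K M y * of K M x)) ^ k ∈ V k := by
    induction k with
    | zero => rw [pow_zero, ← map_one (of K M), ← ht]; exact hVmem le_rfl hN
    | succ k ih =>
      rw [pow_succ, ← mul_assoc]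
      exact hcomm (hVmulA ih z)
  have := hpow N
  rwa [hVN, Submodule.mem_bot] at this

theorem IsHeckeB.commutator_mem_jacobson {K M : Type*} [CommRing K] [Monoid M] {n : ℕ}
    {p : ℕ → M} (h : IsHeckeB n p) (hp : Submonoid.closure (p '' Set.Iio n) = ⊤) {i j : ℕ}
    (hi : i < n) (hj : j < n) :
    MonoidAlgebra.of K M (p i) * MonoidAlgebra.of K M (p j) -
      MonoidAlgebra.of K M (p j) * MonoidAlgebra.of K M (p i) ∈
        Ring.jacobson (MonoidAlgebra K M) := by
  obtain ⟨N, t, hN, ht, htp⟩ := h.exists_monotone_enumeration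
  refine MonoidAlgebra.commutator_mem_jacobson hp hN ht ?_ ⟨i, hi, rfl⟩ ⟨j, hj, rfl⟩
  rintro a ha _ ⟨i, hi, rfl⟩
  exact htp a ha i hi

end Radical

/-! ### The relations of the `0`-rook monoid and of type `A` -/

/-- The relations of the `0`-Hecke monoid of the symmetric group on `n + 1` letters. -/
structure IsHeckeA (n : ℕ) {M : Type*} [Monoid M] (p : ℕ → M) : Prop
    extends IsPathHecke n p where
  braid₀ : 1 < n → p 0 * p 1 * p 0 = p 1 * p 0 * p 1

/-- The relations satisfied by `π_0 = P_1, π_1, …, π_{n-1}` in the `0`-rook monoid. They present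
this monoid, by `IsRook.exists_hom`. -/
structure IsRook (n : ℕ) {M : Type*} [Monoid M] (p : ℕ → M) : Prop
    extends IsPathHecke n p where
  absorb_right : 1 < n → p 0 * p 1 * p 0 * p 1 = p 0 * p 1 * p 0
  absorb_left : 1 < n → p 1 * p 0 * p 1 * p 0 = p 0 * p 1 * p 0

section Relations
variable {M N : Type*} [Monoid M] [Monoid N] {n : ℕ} {p : ℕ → M}

theorem IsPathHecke.map (h : IsPathHecke n p) (φ : M →* N) : IsPathHecke n (fun i => φ (p i)) where
  idem i hi := by simp only [← map_mul, h.idem i hi]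
  comm i j hij hj := by simp only [← map_mul, h.comm i j hij hj]
  braid i hi hi' := by simp only [← map_mul, h.braid i hi hi']

theorem IsRook.isHeckeB (h : IsRook n p) : IsHeckeB n p where
  toIsPathHecke := h.toIsPathHecke
  braid₀ hn := (h.absorb_right hn).trans (h.absorb_left hn).symm

theorem IsHeckeA.isRook (h : IsHeckeA n p) : IsRook n p where
  toIsPathHecke := h.toIsPathHecke
  absorb_right hn := by
    rw [h.braid₀ hn, mul_assoc, h.idem 1 hn]
  absorb_left hn := by
    rw [← h.braid₀ hn, mul_assoc, h.idem 0 (by omega)]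

end Relations

/-! ### The idempotents `P_i` -/

section RookIdempotent
variable {M : Type*} [Monoid M]

/-- The element `P_i` expressed by `p 0 = P_1` and `p j = π_j`; it is the zero of the submonoid
generated by `p 0, …, p (i - 1)`. The value at `0` is `1`. -/
def rookP (p : ℕ → M) : ℕ → M
  | 0 => 1
  | i + 1 => rookP p i * p i * rookP p i

variable {n : ℕ} {p : ℕ → M}

theorem rookP_one : rookP p 1 = p 0 := by simp [rookP]

theorem rookP_mul_rookP_of_absorb {i : ℕ}
    (habs : ∀ j < i, rookP p i * p j = rookP p i) {j : ℕ} (hj : j ≤ i) :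
    rookP p i * rookP p j = rookP p i := by
  induction j with
  | zero => exact mul_one _
  | succ j ih =>
    rw [rookP, ← mul_assoc, ← mul_assoc, ih (by omega), habs j hj, ih (by omega)]

namespace IsRook

theorem commute_rookP (h : IsRook n p) {i j : ℕ} (hij : i < j) (hj : j < n) :
    Commute (rookP p i) (p j) := by
  induction i with
  | zero => exact Commute.one_left _
  | succ i ih =>
    have h₁ := ih (by omega)
    exact (h₁.mul_left (h.comm i j hij hj)).mul_left h₁

/-- `P_i` absorbs `p j` for `j < i`. Only the case `i = j + 1` is not immediate; for `j = 1` it is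
one of the defining relations, and for larger `j` it follows from the braid relation. -/
theorem rookP_mul (h : IsRook n p) {i j : ℕ} (hj : j < i) (hi : i ≤ n) :
    rookP p i * p j = rookP p i := by
  induction i generalizing j with
  | zero => omega
  | succ i ih =>
    rcases Nat.lt_succ_iff_lt_or_eq.1 hj with hj | rfl
    · rw [rookP, mul_assoc, ih hj (by omega)]
    obtain _ | _ | k := j
    · simpa [rookP] using h.idem 0 (by omega)
    · simpa [rookP] using h.absorb_right (by omega)
    -- the second `P_{k+2}` in `P_{k+2} p_{k+2} P_{k+2} p_{k+2}` is `P_{k+1} p_{k+1} P_{k+1}`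
    have hc := (h.commute_rookP (i := k + 1) (j := k + 2) (by omega) (by omega)).eq
    have hb := h.braid (k + 1) (by omega) (by omega)
    have hP : rookP p (k + 2) * p (k + 1) = rookP p (k + 2) := ih (by omega) (by omega)
    have hPP : rookP p (k + 2) * rookP p (k + 1) = rookP p (k + 2) := by
      have habs : ∀ j < k + 2, rookP p (k + 2) * p j = rookP p (k + 2) :=
        fun j hj => ih hj (by omega)
      exact rookP_mul_rookP_of_absorb habs (by omega)
    have hQ : rookP p (k + 2) = rookP p (k + 1) * p (k + 1) * rookP p (k + 1) := rfl
    rw [rookP]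
    simp only [show k + 1 + 1 = k + 2 from rfl] at *
    generalize rookP p (k + 2) = P at *
    generalize rookP p (k + 1) = Q at *
    generalize p (k + 2) = b at *
    generalize p (k + 1) = a at *
    calc P * b * P * b = P * (b * Q) * a * (Q * b) := by rw [hQ]; simp only [mul_assoc]
      _ = P * (Q * b) * a * (b * Q) := by rw [hc]
      _ = P * Q * (b * a * b) * Q := by simp only [mul_assoc]
      _ = P * a * b * a * Q := by rw [hPP, ← hb]; simp only [mul_assoc]
      _ = P * Q * b * a * Q := by rw [hP, hPP]
      _ = P * (Q * b) * a * Q := by simp only [mul_assoc]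
      _ = P * b * P := by rw [hc, hQ]; simp only [mul_assoc]

/-- The relations are invariant under reversing words. With `rookP_op`, this turns statements about
right multiplication on `rookP` into statements about left multiplication. -/
theorem op (h : IsRook n p) : IsRook n (fun i => MulOpposite.op (p i)) where
  idem i hi := congrArg MulOpposite.op (h.idem i hi)
  comm i j hij hj := congrArg MulOpposite.op (h.comm i j hij hj).symm
  braid i hi hi' := by
    have := h.braid i hi hi'
    simp only [← MulOpposite.op_mul, mul_assoc] at this ⊢
    rw [this]
  absorb_right hn := by
    have := h.absorb_left hn
    simp only [← MulOpposite.op_mul, mul_assoc] at this ⊢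
    rw [this]
  absorb_left hn := by
    have := h.absorb_right hn
    simp only [← MulOpposite.op_mul, mul_assoc] at this ⊢
    rw [this]

theorem rookP_op (p : ℕ → M) (i : ℕ) :
    rookP (fun i => MulOpposite.op (p i)) i = MulOpposite.op (rookP p i) := by
  induction i with
  | zero => rfl
  | succ i ih => simp only [rookP, ih, ← MulOpposite.op_mul, mul_assoc]

theorem mul_rookP (h : IsRook n p) {i j : ℕ} (hj : j < i) (hi : i ≤ n) :
    p j * rookP p i = rookP p i := by
  have := h.op.rookP_mul hj hi
  rw [rookP_op] at this
  exact MulOpposite.op_injective this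

theorem rookP_mul_rookP (h : IsRook n p) {i j : ℕ} (hj : j ≤ i) (hi : i ≤ n) :
    rookP p i * rookP p j = rookP p i :=
  rookP_mul_rookP_of_absorb (fun _ hj => h.rookP_mul hj hi) hj

theorem rookP_mul_rookP' (h : IsRook n p) {i j : ℕ} (hj : j ≤ i) (hi : i ≤ n) :
    rookP p j * rookP p i = rookP p i := by
  have := h.op.rookP_mul_rookP hj hi
  rw [rookP_op, rookP_op] at this
  exact MulOpposite.op_injective this

end IsRook
end RookIdempotent

/-! ### The `0`-rook monoid -/

namespace ZeroRookMonoid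

/-- `ZeroRookMonoid.gen` extended by `1` to all natural numbers. -/
def natGen (n i : ℕ) : ZeroRookMonoid n := if h : i < n then gen n ⟨i, h⟩ else 1

theorem natGen_fin {n : ℕ} (i : Fin n) : natGen n i = gen n i := by simp [natGen]

theorem natGen_zero {n : ℕ} (h : 1 ≤ 1 ∧ 1 ≤ n) :
    natGen n 0 = PresentedMonoid.of (RookRel n) (.P 1 h) := by
  rw [natGen, dif_pos (by omega : 0 < n), gen, dif_pos rfl]

theorem natGen_of_pos {n i : ℕ} (h : 1 ≤ i ∧ i < n) :
    natGen n i = PresentedMonoid.of (RookRel n) (.pi i h) := by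
  rw [natGen, dif_pos h.2, gen, dif_neg (by simp; omega)]

theorem isRook (n : ℕ) : IsRook n (natGen n) where
  idem i hi := by
    rcases Nat.eq_zero_or_pos i with rfl | h0
    · rw [natGen_zero ⟨le_rfl, hi⟩]
      exact PresentedMonoid.mk_eq_mk_of_rel (RookRel.P_idem _)
    · rw [natGen_of_pos ⟨h0, hi⟩]
      exact PresentedMonoid.mk_eq_mk_of_rel (RookRel.pi_idem _)
  comm i j hij hj := by
    rw [natGen_of_pos (i := j) ⟨by omega, hj⟩]
    rcases Nat.eq_zero_or_pos i with rfl | h0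
    · rw [natGen_zero ⟨le_rfl, by omega⟩]
      exact PresentedMonoid.mk_eq_mk_of_rel (RookRel.P_pi_comm _ _ (by omega))
    · rw [natGen_of_pos ⟨h0, by omega⟩]
      exact PresentedMonoid.mk_eq_mk_of_rel (RookRel.pi_comm _ _ (Or.inl hij))
  braid i hi hi' := by
    rw [natGen_of_pos (i := i) ⟨hi, by omega⟩, natGen_of_pos (i := i + 1) ⟨by omega, hi'⟩]
    exact PresentedMonoid.mk_eq_mk_of_rel (RookRel.pi_braid _ _ rfl)
  absorb_right hn := by
    rw [natGen_zero ⟨le_rfl, by omega⟩, natGen_of_pos ⟨le_rfl, hn⟩]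
    have h : PresentedMonoid.of (RookRel n) (.P 2 ⟨by omega, hn⟩) = _ :=
      PresentedMonoid.mk_eq_mk_of_rel
        (RookRel.P_succ (i := 1) ⟨le_rfl, by omega⟩ ⟨le_rfl, hn⟩ _ rfl)
    have h' : PresentedMonoid.of (RookRel n) (.P 2 ⟨by omega, hn⟩) * .of _ (.pi 1 ⟨le_rfl, hn⟩) =
        _ :=
      PresentedMonoid.mk_eq_mk_of_rel (RookRel.P_pi_absorb _ _ (by omega))
    exact (congrArg (· * _) h.symm).trans (h'.trans h)
  absorb_left hn := by
    rw [natGen_zero ⟨le_rfl, by omega⟩, natGen_of_pos ⟨le_rfl, hn⟩]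
    have h : PresentedMonoid.of (RookRel n) (.P 2 ⟨by omega, hn⟩) = _ :=
      PresentedMonoid.mk_eq_mk_of_rel
        (RookRel.P_succ (i := 1) ⟨le_rfl, by omega⟩ ⟨le_rfl, hn⟩ _ rfl)
    have h' : PresentedMonoid.of (RookRel n) (.pi 1 ⟨le_rfl, hn⟩) * .of _ (.P 2 ⟨by omega, hn⟩) =
        _ :=
      PresentedMonoid.mk_eq_mk_of_rel (RookRel.pi_P_absorb _ _ (by omega))
    rw [mul_assoc, mul_assoc, ← mul_assoc (PresentedMonoid.of (RookRel n) (.P 1 _))]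
    exact (congrArg (_ * ·) h.symm).trans (h'.trans h)

theorem of_P {n i : ℕ} (h : 1 ≤ i ∧ i ≤ n) :
    PresentedMonoid.of (RookRel n) (.P i h) = rookP (natGen n) i := by
  obtain ⟨h1, h2⟩ := h
  induction i, h1 using Nat.le_induction with
  | base => rw [rookP_one, natGen_zero]
  | succ i hi ih =>
    rw [rookP, ← ih (by omega), natGen_of_pos ⟨hi, by omega⟩]
    exact PresentedMonoid.mk_eq_mk_of_rel (RookRel.P_succ _ _ _ rfl)

theorem rookP_mem {M : Type*} [Monoid M] {p : ℕ → M} {S : Submonoid M} {i : ℕ}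
    (h : ∀ j < i, p j ∈ S) : rookP p i ∈ S := by
  induction i with
  | zero => exact one_mem S
  | succ i ih =>
    have := ih fun j hj => h j (by omega)
    exact mul_mem (mul_mem this (h i (by omega))) this

theorem closure_natGen (n : ℕ) : Submonoid.closure (natGen n '' Set.Iio n) = ⊤ := by
  rw [eq_top_iff, ← PresentedMonoid.closure_range_of, Submonoid.closure_le]
  have hmem (j : ℕ) (hj : j < n) : natGen n j ∈ Submonoid.closure (natGen n '' Set.Iio n) :=
    Submonoid.subset_closure ⟨j, hj, rfl⟩
  rintro _ ⟨g, rfl⟩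
  cases g with
  | pi i h => rw [← natGen_of_pos h]; exact hmem i h.2
  | P i h => rw [of_P h]; exact rookP_mem fun j hj => hmem j (by omega)

end ZeroRookMonoid

/-- The universal property of the `0`-rook monoid in terms of `π_0, …, π_{n-1}`. -/
theorem IsRook.exists_hom {M : Type*} [Monoid M] {n : ℕ} {p : ℕ → M} (h : IsRook n p) :
    ∃ φ : ZeroRookMonoid n →* M, ∀ i < n, φ (ZeroRookMonoid.natGen n i) = p i := by
  let q : RookGen n → M
    | .pi i _ => p i
    | .P i _ => rookP p i
  refine ⟨PresentedMonoid.lift q fun a b hab => ?_, fun i hi => ?_⟩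
  · cases hab with
    | pi_idem hi => exact h.idem _ hi.2
    | @pi_braid i j hi hj hij => subst hij; exact h.braid i hi.1 hj.2
    | pi_comm hi hj hij =>
      rcases hij with hij | hij
      · exact h.comm _ _ hij hj.2
      · exact (h.comm _ _ hij hi.2).symm
    | P_idem hi => exact h.rookP_mul_rookP le_rfl hi.2
    | @P_comm i j hi hj =>
      rcases le_total i j with hij | hij
      · exact (h.rookP_mul_rookP' hij hj.2).trans (h.rookP_mul_rookP hij hj.2).symm
      · exact (h.rookP_mul_rookP hij hi.2).trans (h.rookP_mul_rookP' hij hi.2).symm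
    | P_pi_comm hi hj hij => exact h.commute_rookP hij hj.2
    | P_pi_absorb hi hj hij => exact h.rookP_mul hij hi.2
    | pi_P_absorb hi hj hij => exact h.mul_rookP hij hi.2
    | @P_succ i j hi hi' hj hij => subst hij; rfl
  · rcases Nat.eq_zero_or_pos i with rfl | h0
    · rw [ZeroRookMonoid.natGen_zero ⟨le_rfl, by omega⟩, PresentedMonoid.lift_of]
      exact rookP_one
    · rw [ZeroRookMonoid.natGen_of_pos ⟨h0, hi⟩, PresentedMonoid.lift_of]

/-! ### The `0`-Hecke monoids -/

theorem CoxeterSystem.prod_map_alternatingWord {B N : Type*} [Monoid N] (q : B → N) (i j : B) :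
    ((alternatingWord i j 2).map q).prod = q i * q j ∧
    ((alternatingWord i j 3).map q).prod = q j * q i * q j ∧
    ((alternatingWord i j 4).map q).prod = q i * q j * q i * q j := by
  simp [alternatingWord, mul_assoc]

namespace ZeroHeckeMonoid

variable {n : ℕ} (M : CoxeterMatrix (Fin n))

/-- `ZeroHeckeMonoid.gen` extended by `1` to all natural numbers. -/
def natGen (i : ℕ) : ZeroHeckeMonoid M := if h : i < n then gen M ⟨i, h⟩ else 1

theorem natGen_of_lt {i : ℕ} (h : i < n) : natGen M i = gen M ⟨i, h⟩ := dif_pos h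

theorem natGen_fin (i : Fin n) : natGen M i = gen M i := by simp [natGen]

theorem closure_natGen : Submonoid.closure (natGen M '' Set.Iio n) = ⊤ := by
  rw [eq_top_iff, ← PresentedMonoid.closure_range_of, Submonoid.closure_le]
  rintro _ ⟨i, rfl⟩
  exact Submonoid.subset_closure ⟨i, i.2, natGen_fin M i⟩

theorem gen_mul_gen_self {B : Type} (M : CoxeterMatrix B) (i : B) :
    gen M i * gen M i = gen M i :=
  PresentedMonoid.mk_eq_mk_of_rel (ZeroHeckeRel.idem i)

theorem prod_map_gen_braidWord {B : Type} (M : CoxeterMatrix B) (i j : B) :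
    ((CoxeterSystem.braidWord M i j).map (gen M)).prod =
      ((CoxeterSystem.braidWord M j i).map (gen M)).prod := by
  have h (l : List B) : (l.map (gen M)).prod = PresentedMonoid.mk _ (FreeMonoid.ofList l) := by
    induction l with
    | nil => rfl
    | cons a l ih => rw [List.map_cons, List.prod_cons, ih]; rfl
  rw [h, h]
  exact PresentedMonoid.mk_eq_mk_of_rel (ZeroHeckeRel.braid i j)

/-- The universal property of the `0`-Hecke monoid of a Coxeter matrix. -/
theorem exists_hom {B : Type} (M : CoxeterMatrix B) {N : Type*} [Monoid N] (q : B → N)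
    (hq : ∀ i, q i * q i = q i) (hb : ∀ i j, ((CoxeterSystem.braidWord M i j).map q).prod =
      ((CoxeterSystem.braidWord M j i).map q).prod) :
    ∃ φ : ZeroHeckeMonoid M →* N, ∀ i, φ (gen M i) = q i := by
  refine ⟨PresentedMonoid.lift q fun a b hab => ?_, fun i => PresentedMonoid.lift_of q _⟩
  cases hab with
  | idem i => exact hq i
  | braid i j => rw [FreeMonoid.lift_ofList, FreeMonoid.lift_ofList]; exact hb i j

theorem natGen_idem {n : ℕ} (M : CoxeterMatrix (Fin n)) {i : ℕ} (hi : i < n) :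
    natGen M i * natGen M i = natGen M i := by
  rw [natGen_of_lt M hi]; exact gen_mul_gen_self M _

theorem natGen_comm {n : ℕ} (M : CoxeterMatrix (Fin n)) {i j : ℕ} (hi : i < n) (hj : j < n)
    (h : M ⟨i, hi⟩ ⟨j, hj⟩ = 2) : natGen M i * natGen M j = natGen M j * natGen M i := by
  have := prod_map_gen_braidWord M ⟨i, hi⟩ ⟨j, hj⟩
  rw [CoxeterSystem.braidWord, CoxeterSystem.braidWord, M.symmetric ⟨j, hj⟩, h] at this
  simpa [CoxeterSystem.prod_map_alternatingWord, natGen_of_lt, hi, hj] using this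

theorem natGen_braid_three {n : ℕ} (M : CoxeterMatrix (Fin n)) {i j : ℕ} (hi : i < n) (hj : j < n)
    (h : M ⟨i, hi⟩ ⟨j, hj⟩ = 3) :
    natGen M i * natGen M j * natGen M i = natGen M j * natGen M i * natGen M j := by
  have := prod_map_gen_braidWord M ⟨i, hi⟩ ⟨j, hj⟩
  rw [CoxeterSystem.braidWord, CoxeterSystem.braidWord, M.symmetric ⟨j, hj⟩, h] at this
  simpa only [CoxeterSystem.prod_map_alternatingWord, natGen_of_lt, hi, hj] using this.symm

theorem natGen_braid_four {n : ℕ} (M : CoxeterMatrix (Fin n)) {i j : ℕ} (hi : i < n) (hj : j < n)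
    (h : M ⟨i, hi⟩ ⟨j, hj⟩ = 4) :
    natGen M i * natGen M j * natGen M i * natGen M j =
      natGen M j * natGen M i * natGen M j * natGen M i := by
  have := prod_map_gen_braidWord M ⟨i, hi⟩ ⟨j, hj⟩
  rw [CoxeterSystem.braidWord, CoxeterSystem.braidWord, M.symmetric ⟨j, hj⟩, h] at this
  simpa only [CoxeterSystem.prod_map_alternatingWord, natGen_of_lt, hi, hj] using this

end ZeroHeckeMonoid

theorem coxeterB_apply {n : ℕ} (i j : Fin n) : coxeterB n i j =
    if (i : ℕ) = j then 1 else if ((i : ℕ) = 0 ∧ (j : ℕ) = 1) ∨ ((i : ℕ) = 1 ∧ (j : ℕ) = 0) then 4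
    else if (j : ℕ) + 1 = i ∨ (i : ℕ) + 1 = j then 3 else 2 := by
  obtain ⟨i, hi⟩ := i
  obtain ⟨j, hj⟩ := j
  simp only [coxeterB, CoxeterMatrix.reindex_apply, CoxeterMatrix.B, Matrix.of_apply,
    Fin.revPerm_symm, Fin.revPerm_apply, Fin.ext_iff, Fin.val_rev]
  split_ifs <;> omega

theorem coxeterSymm_apply {n : ℕ} (i j : Fin n) : coxeterSymm n i j =
    if (i : ℕ) = j then 1 else if (j : ℕ) + 1 = i ∨ (i : ℕ) + 1 = j then 3 else 2 := by
  simp only [coxeterSymm, CoxeterMatrix.A, Matrix.of_apply, Fin.ext_iff]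

section Universal

open ZeroHeckeMonoid

theorem isHeckeB_natGen (n : ℕ) : IsHeckeB n (natGen (coxeterB n)) where
  idem i hi := natGen_idem _ hi
  comm i j hij hj := natGen_comm _ (by omega) hj (by rw [coxeterB_apply]; grind)
  braid i hi hi' := natGen_braid_three _ (by omega) hi' (by rw [coxeterB_apply]; grind)
  braid₀ hn := natGen_braid_four _ (by omega) hn (by rw [coxeterB_apply]; grind)

theorem isHeckeA_natGen (n : ℕ) : IsHeckeA n (natGen (coxeterSymm n)) where
  idem i hi := natGen_idem _ hi
  comm i j hij hj := natGen_comm _ (by omega) hj (by rw [coxeterSymm_apply]; grind)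
  braid i hi hi' := natGen_braid_three _ (by omega) hi' (by rw [coxeterSymm_apply]; grind)
  braid₀ hn := natGen_braid_three _ (by omega) hn (by rw [coxeterSymm_apply]; grind)

theorem IsHeckeB.exists_hom {N : Type*} [Monoid N] {n : ℕ} {p : ℕ → N} (h : IsHeckeB n p) :
    ∃ φ : ZeroHeckeMonoid (coxeterB n) →* N, ∀ i < n, φ (natGen (coxeterB n) i) = p i := by
  have key (i j : Fin n) (hij : i < j) :
      ((CoxeterSystem.braidWord (coxeterB n) i j).map fun i : Fin n => p i).prod =
      ((CoxeterSystem.braidWord (coxeterB n) j i).map fun i : Fin n => p i).prod := by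
    rw [CoxeterSystem.braidWord, CoxeterSystem.braidWord, (coxeterB n).symmetric j, coxeterB_apply]
    obtain ⟨i, hi⟩ := i
    obtain ⟨j, hj⟩ := j
    rw [Fin.mk_lt_mk] at hij
    rw [if_neg hij.ne]
    dsimp only
    split_ifs with h1 h2
    · obtain ⟨rfl, rfl⟩ : i = 0 ∧ j = 1 := by omega
      simpa only [CoxeterSystem.prod_map_alternatingWord] using h.braid₀ hj
    · obtain rfl : j = i + 1 := by omega
      simpa only [CoxeterSystem.prod_map_alternatingWord] using (h.braid i (by omega) hj).symm
    · simpa only [CoxeterSystem.prod_map_alternatingWord] using h.comm i j (by omega) hj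
  obtain ⟨φ, hφ⟩ := ZeroHeckeMonoid.exists_hom (coxeterB n) (fun i => p i) (fun i => h.idem i i.2)
    fun i j => by
      rcases lt_trichotomy i j with hij | rfl | hij
      · exact key i j hij
      · rfl
      · exact (key j i hij).symm
  exact ⟨φ, fun i hi => by rw [natGen_of_lt _ hi, hφ]⟩

theorem IsHeckeA.exists_hom {N : Type*} [Monoid N] {n : ℕ} {p : ℕ → N} (h : IsHeckeA n p) :
    ∃ φ : ZeroHeckeMonoid (coxeterSymm n) →* N, ∀ i < n, φ (natGen (coxeterSymm n) i) = p i := by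
  have key (i j : Fin n) (hij : i < j) :
      ((CoxeterSystem.braidWord (coxeterSymm n) i j).map fun i : Fin n => p i).prod =
      ((CoxeterSystem.braidWord (coxeterSymm n) j i).map fun i : Fin n => p i).prod := by
    rw [CoxeterSystem.braidWord, CoxeterSystem.braidWord, (coxeterSymm n).symmetric j,
      coxeterSymm_apply]
    obtain ⟨i, hi⟩ := i
    obtain ⟨j, hj⟩ := j
    rw [Fin.mk_lt_mk] at hij
    rw [if_neg hij.ne]
    dsimp only
    split_ifs with h2
    · obtain rfl : j = i + 1 := by omega
      rcases Nat.eq_zero_or_pos i with rfl | h0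
      · simpa only [CoxeterSystem.prod_map_alternatingWord] using (h.braid₀ hj).symm
      · simpa only [CoxeterSystem.prod_map_alternatingWord] using (h.braid i h0 hj).symm
    · simpa only [CoxeterSystem.prod_map_alternatingWord] using h.comm i j (by omega) hj
  obtain ⟨φ, hφ⟩ := ZeroHeckeMonoid.exists_hom (coxeterSymm n) (fun i => p i)
    (fun i => h.idem i i.2) fun i j => by
      rcases lt_trichotomy i j with hij | rfl | hij
      · exact key i j hij
      · rfl
      · exact (key j i hij).symm
  exact ⟨φ, fun i hi => by rw [natGen_of_lt _ hi, hφ]⟩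

end Universal

/-! ### Kernels of maps between monoid algebras -/

section MonoidAlgebra
variable {K M N : Type*} [CommRing K] [Monoid M] [Monoid N]

theorem MonoidHom.surjective_of_closure {s : Set N} (hs : Submonoid.closure s = ⊤) (φ : M →* N)
    (h : ∀ x ∈ s, ∃ y, φ y = x) : Function.Surjective φ := by
  rw [← MonoidHom.mrange_eq_top, eq_top_iff, ← hs, Submonoid.closure_le]
  exact fun x hx => h x hx

theorem MonoidAlgebra.mapDomainAlgHom_of (φ : M →* N) (m : M) :
    mapDomainAlgHom K K φ (of K M m) = of K N (φ m) := by
  simp [of]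

theorem MonoidAlgebra.mapDomainAlgHom_surjective {φ : M →* N} (hφ : Function.Surjective φ) :
    Function.Surjective (mapDomainAlgHom K K φ) := by
  intro y
  induction y using MonoidAlgebra.induction_on with
  | of m =>
    obtain ⟨m, rfl⟩ := hφ m
    exact ⟨of K M m, mapDomainAlgHom_of φ m⟩
  | add x y hx hy =>
    obtain ⟨x, rfl⟩ := hx
    obtain ⟨y, rfl⟩ := hy
    exact ⟨x + y, map_add _ _ _⟩
  | smul c x hx =>
    obtain ⟨x, rfl⟩ := hx
    exact ⟨c • x, map_smul _ _ _⟩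

/-- If the map from `M` to its monoid algebra modulo a two-sided ideal `I` factors through `φ`, then
`I` contains the kernel of the algebra map induced by `φ`. -/
theorem MonoidAlgebra.ker_mapDomainAlgHom_le {φ : M →* N} {G : Set M}
    (hG : Submonoid.closure G = ⊤) {I : Ideal (MonoidAlgebra K M)} [I.IsTwoSided]
    (ψ : N →* MonoidAlgebra K M ⧸ I) (hψ : ∀ m ∈ G, ψ (φ m) = Ideal.Quotient.mk I (of K M m)) :
    RingHom.ker (mapDomainAlgHom K K φ) ≤ I := by
  have h : ψ.comp φ = (Ideal.Quotient.mk I).toMonoidHom.comp (of K M) :=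
    MonoidHom.eq_of_eqOn_denseM hG hψ
  have h' (u : MonoidAlgebra K M) :
      lift K _ N ψ (mapDomainAlgHom K K φ u) = Ideal.Quotient.mk I u := by
    induction u using MonoidAlgebra.induction_on with
    | of m =>
      rw [mapDomainAlgHom_of, lift_of]
      exact DFunLike.congr_fun h m
    | add x y hx hy => rw [map_add, map_add, hx, hy, map_add]
    | smul c x hx => rw [map_smul, map_smul, hx]; rfl
  intro u hu
  rw [← Ideal.Quotient.eq_zero_iff_mem, ← h', (RingHom.mem_ker).1 hu, map_zero]

end MonoidAlgebra

theorem Ideal.mul_mem_sq {A : Type*} [Ring A] {I : Ideal A} {x y : A} (hx : x ∈ I) (hy : y ∈ I) :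
    x * y ∈ I ^ 2 := by
  rw [Submodule.pow_succ, Submodule.pow_one]
  exact Ideal.mul_mem_mul hx hy

/-! ### The two surjections -/

/-- The additional relation of the `0`-rook monoid as a product of two multiples of a commutator. -/
theorem mul_commutator_mul_commutator_mul {A : Type*} [Ring A] {x y : A} (hx : x * x = x)
    (hy : y * y = y) (h : x * y * x * y = y * x * y * x) :
    x * (x * y - y * x) * ((x * y - y * x) * x) = x * y * x * y - x * y * x := by
  have hx' (z : A) : z * x * x = z * x := by rw [mul_assoc, hx]
  have hy' (z : A) : z * y * y = z * y := by rw [mul_assoc, hy]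
  have h' : x * y * x * y * x = x * y * x * y := by rw [h, hx']
  simp only [mul_sub, sub_mul, ← mul_assoc, hx, hx', hy', h']
  abel

/-- The additional relation of `H⁰_{n+1}` over the `0`-rook monoid as the square of a commutator. -/
theorem commutator_sq_of_absorb {A : Type*} [Ring A] {x y : A} (hx : x * x = x) (hy : y * y = y)
    (h : x * y * x * y = x * y * x) (h' : y * x * y * x = x * y * x) :
    (x * y - y * x) * (x * y - y * x) = x * y * x - y * x * y := by
  have hx' (z : A) : z * x * x = z * x := by rw [mul_assoc, hx]
  have hy' (z : A) : z * y * y = z * y := by rw [mul_assoc, hy]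
  simp only [mul_sub, sub_mul, ← mul_assoc, hx', hy', h, h']
  abel

section Surjections

open MonoidAlgebra ZeroHeckeMonoid

variable (n : ℕ)

theorem exists_algHom_heckeB_rook :
    ∃ f : MonoidAlgebra ℂ (ZeroHeckeMonoid (coxeterB n)) →ₐ[ℂ]
        MonoidAlgebra ℂ (ZeroRookMonoid n),
      (∀ i : Fin n, f (of ℂ _ (gen (coxeterB n) i)) = of ℂ _ (ZeroRookMonoid.gen n i)) ∧
      Function.Surjective f ∧
      RingHom.ker f ≤ Ring.jacobson (MonoidAlgebra ℂ (ZeroHeckeMonoid (coxeterB n))) ^ 2 := by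
  obtain ⟨φ, hφ⟩ := (ZeroRookMonoid.isRook n).isHeckeB.exists_hom
  have hB := isHeckeB_natGen n
  have hG := closure_natGen (coxeterB n)
  set p := natGen (coxeterB n) with hp
  set J := Ring.jacobson (MonoidAlgebra ℂ (ZeroHeckeMonoid (coxeterB n))) with hJ
  let π := (Ideal.Quotient.mk (J ^ 2)).toMonoidHom.comp (of ℂ (ZeroHeckeMonoid (coxeterB n)))
  have hsurj : Function.Surjective φ :=
    φ.surjective_of_closure (ZeroRookMonoid.closure_natGen n) (by
      rintro _ ⟨i, hi, rfl⟩; exact ⟨_, hφ i hi⟩)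
  -- the relations of the `0`-rook monoid hold modulo `J ^ 2`
  have hR : IsRook n (fun i => π (p i)) := by
    have hX (hn : 1 < n) : π (p 0 * p 1 * p 0 * p 1) = π (p 0 * p 1 * p 0) := by
      refine Ideal.Quotient.eq.2 ?_
      have hc := hB.commutator_mem_jacobson (K := ℂ) hG (zero_lt_one.trans hn) hn
      have h := Ideal.mul_mem_sq (J.mul_mem_left (of ℂ _ (p 0)) hc)
        (J.mul_mem_right (of ℂ _ (p 0)) hc)
      rw [mul_commutator_mul_commutator_mul (by rw [← map_mul, hB.idem 0 (by omega)])
        (by rw [← map_mul, hB.idem 1 hn]) (by simp only [← map_mul, hB.braid₀ hn])] at h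
      simpa only [map_mul] using h
    refine ⟨hB.toIsPathHecke.map π, fun hn => ?_, fun hn => ?_⟩
    · simpa only [map_mul] using hX hn
    · simpa only [hB.braid₀ hn, map_mul] using hX hn
  obtain ⟨ψ, hψ⟩ := hR.exists_hom
  refine ⟨mapDomainAlgHom ℂ ℂ φ, fun i => ?_, mapDomainAlgHom_surjective hsurj,
    ker_mapDomainAlgHom_le hG ψ ?_⟩
  · rw [mapDomainAlgHom_of, ← natGen_fin, hφ i i.2, ZeroRookMonoid.natGen_fin]
  · rintro _ ⟨i, hi, rfl⟩
    rw [hφ i hi, hψ i hi]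
    rfl

theorem exists_algHom_rook_heckeA :
    ∃ g : MonoidAlgebra ℂ (ZeroRookMonoid n) →ₐ[ℂ]
        MonoidAlgebra ℂ (ZeroHeckeMonoid (coxeterSymm n)),
      (∀ i : Fin n, g (of ℂ _ (ZeroRookMonoid.gen n i)) = of ℂ _ (gen (coxeterSymm n) i)) ∧
      Function.Surjective g ∧
      RingHom.ker g ≤ Ring.jacobson (MonoidAlgebra ℂ (ZeroRookMonoid n)) ^ 2 := by
  obtain ⟨φ, hφ⟩ := (isHeckeA_natGen n).isRook.exists_hom
  have hB := ZeroRookMonoid.isRook n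
  have hG := ZeroRookMonoid.closure_natGen n
  set p := ZeroRookMonoid.natGen n with hp
  set J := Ring.jacobson (MonoidAlgebra ℂ (ZeroRookMonoid n)) with hJ
  let π := (Ideal.Quotient.mk (J ^ 2)).toMonoidHom.comp (of ℂ (ZeroRookMonoid n))
  have hsurj : Function.Surjective φ :=
    φ.surjective_of_closure (closure_natGen (coxeterSymm n)) (by
      rintro _ ⟨i, hi, rfl⟩; exact ⟨_, hφ i hi⟩)
  -- the relations of type `A` hold modulo `J ^ 2`
  have hR : IsHeckeA n (fun i => π (p i)) := by
    have hX (hn : 1 < n) : π (p 0 * p 1 * p 0) = π (p 1 * p 0 * p 1) := by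
      refine Ideal.Quotient.eq.2 ?_
      have hc := hB.isHeckeB.commutator_mem_jacobson (K := ℂ) hG (zero_lt_one.trans hn) hn
      have h := Ideal.mul_mem_sq hc hc
      rw [commutator_sq_of_absorb (by rw [← map_mul, hB.idem 0 (by omega)])
        (by rw [← map_mul, hB.idem 1 hn]) (by simp only [← map_mul, hB.absorb_right hn])
        (by simp only [← map_mul, hB.absorb_left hn])] at h
      simpa only [map_mul] using h
    refine ⟨hB.toIsPathHecke.map π, fun hn => ?_⟩
    simpa only [map_mul] using hX hn
  obtain ⟨ψ, hψ⟩ := hR.exists_hom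
  refine ⟨mapDomainAlgHom ℂ ℂ φ, fun i => ?_, mapDomainAlgHom_surjective hsurj,
    ker_mapDomainAlgHom_le hG ψ ?_⟩
  · rw [mapDomainAlgHom_of, ← ZeroRookMonoid.natGen_fin, hφ i i.2, natGen_fin]
  · rintro _ ⟨i, hi, rfl⟩
    rw [hφ i hi, hψ i hi]
    rfl

end Surjections

theorem mainTheorem9 (n : ℕ) :
    (∃ (f : MonoidAlgebra ℂ (ZeroHeckeMonoid (coxeterB n)) →ₐ[ℂ]
          MonoidAlgebra ℂ (ZeroRookMonoid n))
        (g : MonoidAlgebra ℂ (ZeroRookMonoid n) →ₐ[ℂ]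
          MonoidAlgebra ℂ (ZeroHeckeMonoid (coxeterSymm n))),
      (∀ i : Fin n, f (MonoidAlgebra.of ℂ _ (ZeroHeckeMonoid.gen (coxeterB n) i)) =
        MonoidAlgebra.of ℂ _ (ZeroRookMonoid.gen n i)) ∧
      (∀ i : Fin n, g (MonoidAlgebra.of ℂ _ (ZeroRookMonoid.gen n i)) =
        MonoidAlgebra.of ℂ _ (ZeroHeckeMonoid.gen (coxeterSymm n) i)) ∧
      Function.Surjective f ∧
      Function.Surjective g ∧
      RingHom.ker f ≤ Ring.jacobson (MonoidAlgebra ℂ (ZeroHeckeMonoid (coxeterB n))) ^ 2 ∧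
      RingHom.ker g ≤ Ring.jacobson (MonoidAlgebra ℂ (ZeroRookMonoid n)) ^ 2) ∧
    Nonempty (Quiv.of (ExtQuiver (MonoidAlgebra ℂ (ZeroHeckeMonoid (coxeterB n)))) ≅
      Quiv.of (ExtQuiver (MonoidAlgebra ℂ (ZeroRookMonoid n)))) ∧
    Nonempty (Quiv.of (ExtQuiver (MonoidAlgebra ℂ (ZeroRookMonoid n))) ≅
      Quiv.of (ExtQuiver (MonoidAlgebra ℂ (ZeroHeckeMonoid (coxeterSymm n))))) := by
  obtain ⟨f, hf, hf', hf''⟩ := exists_algHom_heckeB_rook n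
  obtain ⟨g, hg, hg', hg''⟩ := exists_algHom_rook_heckeA n
  exact ⟨⟨f, g, hf, hg, hf', hg', hf'', hg''⟩, ExtQuiver.nonempty_iso_of_ker_le f hf' hf'',
    ExtQuiver.nonempty_iso_of_ker_le g hg' hg''⟩
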